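/- Let $n,k\ge 0$. A noncrossing graph with $n+1$ vertices is a graph on the points $1,\dots,n+1$, placed in this order on a circle, whose edges, drawn as chords, do not cross. Every cycle of such a graph has the form $(i_1,i_2),(i_2,i_3),\dots,(i_{r-1},i_r),(i_r,i_1)$ with $i_1<i_2<\dots<i_r$; deleting from a connected noncrossing graph $G$, for each cycle of this form, the edge $(i_1,i_2)$ leaves a spanning tree, the canonical spanning tree $T$ of $G$, rooted at $1$. The edges of $G$ not in $T$ are called free. A descent of $T$ is an edge $(i,j)$ of $T$ with $i>j$ such that $i$ is on the path from the root to $j$. Its companion edge is $(w,j)$, defined as follows: let $v$ be the vertex nearest to the root on the maximal path of consecutive descents from $j$ back towards the root; then $w$ is the largest vertex less than $j$ among the neighbours in $T$ of the vertices on the path from $v$ to $i$, the vertices of the path excepted. Let $\mathcal N_{n,k}$ be the set of connected noncrossing graphs with $n+1$ vertices in which exactly $k$ free edges are marked. A descent of the canonical spanning tree is marked if its companion edge is a marked edge, and unmarked otherwise. Let $\mathcal D_{n,k}$ be the set of those members of $\mathcal N_{n,k}$ that have $n+k$ edges and in which each descent of the canonical spanning tree is marked. Descents $(i,j)$ are ordered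 by their lower ends $j$. Then $\mathcal N_{n,k}-\mathcal D_{n,k}$ is exactly the set of members of $\mathcal N_{n,k}$ with at least one unmarked descent, and there is an involution on $\mathcal N_{n,k}-\mathcal D_{n,k}$ that changes the number of free edges by exactly one (in particular, it reverses the parity of this number): it deletes the companion edge of the minimal unmarked descent if that edge is in $G$, adds it if it is not, and keeps the marked edges. -/

import Mathlib

namespace NoncrossingGraph

/-- A graph on the points `0, 1, …, n`, placed in this order on a circle, is noncrossing if no two
of its edges (drawn as chords) cross. -/
def IsNoncrossing {n : ℕ} (G : SimpleGraph (Fin (n + 1))) : Prop :=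
  ∀ a b c d : Fin (n + 1), a < b → b < c → c < d → G.Adj a c → ¬ G.Adj b d

/-- `c 0 < c 1 < ⋯ < c (k + 2)` are the vertices of a cycle of `G`, with edges
`(c 0, c 1), …, (c (k + 1), c (k + 2)), (c (k + 2), c 0)`. -/
structure IsIncreasingCycle {n : ℕ} (G : SimpleGraph (Fin (n + 1))) {k : ℕ}
    (c : Fin (k + 3) → Fin (n + 1)) : Prop where
  strictMono : StrictMono c
  adj_succ : ∀ t : Fin (k + 2), G.Adj (c t.castSucc) (c t.succ)
  adj_last : G.Adj (c (Fin.last (k + 2))) (c 0)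

/-- `(a, b)` is the edge joining the two smallest vertices of some cycle of `G`. -/
def IsFirstEdge {n : ℕ} (G : SimpleGraph (Fin (n + 1))) (a b : Fin (n + 1)) : Prop :=
  ∃ (k : ℕ) (c : Fin (k + 3) → Fin (n + 1)), IsIncreasingCycle G c ∧ c 0 = a ∧ c 1 = b

/-- The canonical spanning tree: for each cycle `i₁ < i₂ < ⋯ < iₖ` of `G`, the edge `(i₁, i₂)` is
deleted. See `eq_canonicalTree_of_deletions` for the step-by-step deletion procedure. -/
def canonicalTree {n : ℕ} (G : SimpleGraph (Fin (n + 1))) : SimpleGraph (Fin (n + 1)) :=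
  G.deleteEdges {e | ∃ a b, IsFirstEdge G a b ∧ e = s(a, b)}

/-- One step of the deletion procedure: choose a cycle of the current graph, and delete the edge
joining its two smallest vertices. -/
def DeletionStep {n : ℕ} (G G' : SimpleGraph (Fin (n + 1))) : Prop :=
  ∃ a b, IsFirstEdge G a b ∧ G' = G.deleteEdges {s(a, b)}

/-- The edges of `G` other than `ab` among the vertices `a` and `≥ b`. -/
def Detour {n : ℕ} (G : SimpleGraph (Fin (n + 1))) (a b x y : Fin (n + 1)) : Prop :=
  G.Adj x y ∧ (x = a ∨ b ≤ x) ∧ (y = a ∨ b ≤ y) ∧ s(x, y) ≠ s(a, b)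

theorem IsFirstEdge.lt {n : ℕ} {G : SimpleGraph (Fin (n + 1))} {a b : Fin (n + 1)}
    (h : IsFirstEdge G a b) : a < b := by
  obtain ⟨k, c, hc, rfl, rfl⟩ := h
  exact hc.strictMono (by simp)

theorem IsFirstEdge.mono {n : ℕ} {G H : SimpleGraph (Fin (n + 1))} (hle : H ≤ G)
    {a b : Fin (n + 1)} (h : IsFirstEdge H a b) : IsFirstEdge G a b := by
  obtain ⟨k, c, hc, h0, h1⟩ := h
  exact ⟨k, c, ⟨hc.strictMono, fun t => hle (hc.adj_succ t), hle hc.adj_last⟩, h0, h1⟩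

theorem Detour.symm {n : ℕ} {G : SimpleGraph (Fin (n + 1))} {a b x y : Fin (n + 1)}
    (h : Detour G a b x y) : Detour G a b y x :=
  ⟨h.1.symm, h.2.2.1, h.2.1, by rw [Sym2.eq_swap]; exact h.2.2.2⟩

theorem IsFirstEdge.detour {n : ℕ} {G : SimpleGraph (Fin (n + 1))} {a b : Fin (n + 1)}
    (h : IsFirstEdge G a b) : Relation.ReflTransGen (Detour G a b) b a := by
  have hab := h.lt
  obtain ⟨k, c, hc, rfl, rfl⟩ := h
  have hge : ∀ t : Fin (k + 2), c 1 ≤ c t.succ := fun t =>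
    hc.strictMono.monotone (by simp [Fin.le_def])
  have key : ∀ m : ℕ, ∀ hm : m < k + 2,
      Relation.ReflTransGen (Detour G (c 0) (c 1)) (c 1) (c (Fin.succ ⟨m, hm⟩)) := by
    intro m
    induction m with
    | zero => intro hm; exact Relation.ReflTransGen.refl
    | succ m ih =>
      intro hm
      refine (ih (by omega)).tail ⟨hc.adj_succ ⟨m + 1, hm⟩, Or.inr (hge _), Or.inr (hge _), ?_⟩
      intro he
      have h0 : c 0 ∈ s(c (Fin.succ ⟨m, by omega⟩), c (Fin.succ ⟨m + 1, hm⟩)) := by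
        have : c 0 ∈ s(c 0, c 1) := by simp
        rw [← he] at this
        exact this
      rcases Sym2.mem_iff.1 h0 with h0 | h0
      · exact absurd (h0 ▸ hge _) (not_le.2 hab)
      · exact absurd (h0 ▸ hge _) (not_le.2 hab)
  refine (key (k + 1) (by omega)).tail ⟨hc.adj_last, Or.inr (hge ⟨k + 1, by omega⟩), Or.inl rfl, ?_⟩
  intro he
  have h1 : c 1 < c (Fin.last (k + 2)) := hc.strictMono (by simp [Fin.lt_def])
  rcases Sym2.eq_iff.1 he with ⟨h2, -⟩ | ⟨h2, -⟩
  · exact absurd (h2 ▸ h1) (not_lt.2 hab.le)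
  · exact h1.ne h2.symm

theorem DeletionStep.detour {n : ℕ} {G G' : SimpleGraph (Fin (n + 1))} (h : DeletionStep G G')
    {a b x y : Fin (n + 1)} (hab : a < b) (hxy : Relation.ReflTransGen (Detour G a b) x y) :
    Relation.ReflTransGen (Detour G' a b) x y := by
  obtain ⟨c, d, hcd, rfl⟩ := h
  have hlt := hcd.lt
  have loop : Detour G a b c d →
      Relation.ReflTransGen (Detour (G.deleteEdges {s(c, d)}) a b) d c := by
    rintro ⟨-, hc, hd, hne⟩
    have hbd : b ≤ d := by
      rcases hd with rfl | hd
      · rcases hc with rfl | hc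
        · exact absurd hlt (lt_irrefl _)
        · exact hc.trans hlt.le
      · exact hd
    refine Relation.ReflTransGen.mono ?_ _ _ hcd.detour
    rintro u v ⟨huv, hu, hv, hn⟩
    have aux : ∀ z, z = c ∨ d ≤ z → z = a ∨ b ≤ z := by
      rintro z (rfl | hz)
      · exact hc
      · exact Or.inr (hbd.trans hz)
    refine ⟨?_, aux u hu, aux v hv, ?_⟩
    · rw [SimpleGraph.deleteEdges_adj]
      exact ⟨huv, hn⟩
    · intro he
      have ha : a = c := by
        have : a ∈ s(u, v) := by rw [he]; simp
        rcases Sym2.mem_iff.1 this with rfl | rfl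
        · rcases hu with h | h
          · exact h
          · exact absurd (hab.trans_le (hbd.trans h)) (lt_irrefl _)
        · rcases hv with h | h
          · exact h
          · exact absurd (hab.trans_le (hbd.trans h)) (lt_irrefl _)
      have hb : b = d := by
        have : b ∈ s(u, v) := by rw [he]; simp
        rcases Sym2.mem_iff.1 this with rfl | rfl
        · rcases hu with h | h
          · exact absurd (ha.trans h.symm) hab.ne
          · exact le_antisymm hbd h
        · rcases hv with h | h
          · exact absurd (ha.trans h.symm) hab.ne
          · exact le_antisymm hbd h
      exact hne (by rw [ha, hb])
  have hsymm := @Relation.ReflTransGen.stdSymm _ (Detour (G.deleteEdges {s(c, d)}) a b)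
    ⟨fun _ _ h => h.symm⟩
  induction hxy with
  | refl => exact Relation.ReflTransGen.refl
  | @tail u v _ huv ih =>
    by_cases he : s(u, v) = s(c, d)
    · rcases Sym2.eq_iff.1 he with ⟨rfl, rfl⟩ | ⟨rfl, rfl⟩
      · exact ih.trans (hsymm.symm _ _ (loop huv))
      · exact ih.trans (loop huv.symm)
    · refine ih.tail ⟨?_, huv.2⟩
      rw [SimpleGraph.deleteEdges_adj]
      exact ⟨huv.1, he⟩

/-- If the step-by-step deletion procedure, with whatever choices of cycles, arrives at a tree, then
this tree is `canonicalTree G`. -/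
theorem eq_canonicalTree_of_deletions {n : ℕ} {G T : SimpleGraph (Fin (n + 1))}
    (h : Relation.ReflTransGen DeletionStep G T) (hT : T.IsTree) : T = canonicalTree G := by
  have inv : T ≤ G ∧ canonicalTree G ≤ T ∧ ∀ a b, IsFirstEdge G a b →
      Relation.ReflTransGen (Detour T a b) b a := by
    clear hT
    induction h with
    | refl =>
      exact ⟨le_rfl, SimpleGraph.deleteEdges_le _, fun a b hab => hab.detour⟩
    | @tail H H' _ hs ih =>
      obtain ⟨h1, h2, h3⟩ := ih
      refine ⟨?_, ?_, fun a b hab => hs.detour hab.lt (h3 a b hab)⟩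
      · obtain ⟨c, d, -, rfl⟩ := hs
        exact (SimpleGraph.deleteEdges_le _).trans h1
      · obtain ⟨c, d, hcd, rfl⟩ := hs
        intro x y hxy
        rw [SimpleGraph.deleteEdges_adj]
        refine ⟨h2 hxy, fun he => ?_⟩
        rw [canonicalTree, SimpleGraph.deleteEdges_adj] at hxy
        exact hxy.2 ⟨c, d, hcd.mono h1, he⟩
  obtain ⟨h1, h2, h3⟩ := inv
  refine le_antisymm ?_ h2
  intro x y hxy
  rw [canonicalTree, SimpleGraph.deleteEdges_adj]
  refine ⟨h1 hxy, ?_⟩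
  rintro ⟨a, b, hab, he⟩
  have hTab : T.Adj a b := by
    rw [← SimpleGraph.mem_edgeSet, he] at hxy
    exact hxy
  have hbr := SimpleGraph.isAcyclic_iff_forall_adj_isBridge.1 hT.isAcyclic hTab
  rw [SimpleGraph.isBridge_iff] at hbr
  refine hbr (SimpleGraph.Reachable.symm ?_)
  rw [SimpleGraph.reachable_iff_reflTransGen]
  refine Relation.ReflTransGen.mono ?_ _ _ (h3 a b hab)
  rintro u v ⟨huv, -, -, hn⟩
  rw [SimpleGraph.deleteEdges_adj]
  exact ⟨huv, hn⟩

/-- `(i, j)` is a descent of the tree `T` rooted at the smallest vertex `0`: an edge with `i > j`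
such that `i` is on the path from the root to `j`. -/
def IsDescent {n : ℕ} (T : SimpleGraph (Fin (n + 1))) (i j : Fin (n + 1)) : Prop :=
  T.Adj i j ∧ j < i ∧ ∃ p : T.Walk 0 j, p.IsPath ∧ i ∈ p.support

/-- `u` is on the maximal path of consecutive descents from `j` back towards the root. -/
def OnDescentPath {n : ℕ} (T : SimpleGraph (Fin (n + 1))) (j u : Fin (n + 1)) : Prop :=
  Relation.ReflTransGen (fun x y => IsDescent T y x) j u

/-- `(w, j)` is the companion edge of the descent `(i, j)` of the tree `T`. If `v` is the vertex
nearest to the root on the maximal path of consecutive descents from `j` back towards the root, then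
`w` is the largest vertex less than `j` among the neighbours, in `T`, of the vertices on the path
from `v` to `i`, the vertices of the path excepted. -/
def IsCompanion {n : ℕ} (T : SimpleGraph (Fin (n + 1))) (i j w : Fin (n + 1)) : Prop :=
  IsGreatest {x | x < j ∧ ¬ OnDescentPath T j x ∧ ∃ u, OnDescentPath T i u ∧ T.Adj u x} w

/-- The free edges of `G`: those that are not in its canonical spanning tree. -/
def freeEdges {n : ℕ} (G : SimpleGraph (Fin (n + 1))) : Set (Sym2 (Fin (n + 1))) :=
  G.edgeSet \ (canonicalTree G).edgeSet

/-- A graph on `n + 1` vertices together with a set of marked edges. -/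
@[ext]
structure MarkedGraph (n : ℕ) where
  /-- the graph -/
  graph : SimpleGraph (Fin (n + 1))
  /-- the set of marked edges -/
  marked : Finset (Sym2 (Fin (n + 1)))

/-- The canonical spanning tree of the underlying graph. -/
def MarkedGraph.tree {n : ℕ} (x : MarkedGraph n) : SimpleGraph (Fin (n + 1)) :=
  canonicalTree x.graph

/-- The number of free edges, marked or not. -/
noncomputable def MarkedGraph.numFree {n : ℕ} (x : MarkedGraph n) : ℕ :=
  (freeEdges x.graph).ncard

/-- A descent of the canonical spanning tree is marked if its companion edge is marked. -/
def MarkedGraph.IsMarkedDescent {n : ℕ} (x : MarkedGraph n) (i j : Fin (n + 1)) : Prop :=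
  IsDescent x.tree i j ∧ ∃ w, IsCompanion x.tree i j w ∧ s(w, j) ∈ x.marked

/-- A descent of the canonical spanning tree that is not marked. -/
def MarkedGraph.IsUnmarkedDescent {n : ℕ} (x : MarkedGraph n) (i j : Fin (n + 1)) : Prop :=
  IsDescent x.tree i j ∧ ¬ x.IsMarkedDescent i j

/-- `(i, j)` is the minimal unmarked descent; descents `(i, j)` are compared by `j`. -/
def MarkedGraph.IsMinUnmarkedDescent {n : ℕ} (x : MarkedGraph n) (i j : Fin (n + 1)) : Prop :=
  x.IsUnmarkedDescent i j ∧ ∀ i' j', x.IsUnmarkedDescent i' j' → j ≤ j'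

/-- The connected noncrossing graphs with `n + 1` vertices and `k` marked free edges. -/
def setN (n k : ℕ) : Set (MarkedGraph n) :=
  {x | x.graph.Connected ∧ IsNoncrossing x.graph ∧
    (x.marked : Set (Sym2 (Fin (n + 1)))) ⊆ freeEdges x.graph ∧ x.marked.card = k}

/-- The members of `setN n k` with `n + k` edges in which each descent of the canonical spanning
tree is marked. -/
def setD (n k : ℕ) : Set (MarkedGraph n) :=
  {x | x ∈ setN n k ∧ x.graph.edgeSet.ncard = n + k ∧
    ∀ i j, IsDescent x.tree i j → x.IsMarkedDescent i j}

end NoncrossingGraph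

open NoncrossingGraph

/-! The point is that descents of the canonical spanning tree `T` account for all free edges, and
that companion edges can be switched on and off without disturbing `T`.

Let `(a, b)`, `a < b`, be free. Then `T` plus this edge has a cycle with first edge `(a, b)`, since
a first edge in a subgraph of `G` is one in `G` and so is not in `T`. The rest of the cycle climbs
from `b` to a neighbour `y` of `a`; by planarity it consists of descents
(`onDescentPath_of_upStep`), and `(a, b)` is the companion of the first of them
(`exists_isCompanion_of_free`). So if all descents are marked, all free edges are marked, and `G`
has `n + k` edges.

Conversely, the companion of a descent crosses no edge of `G` (`IsCompanion.isNoncrossing_sup`), and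
it is the first edge of a cycle once added, so `T` survives (`IsCompanion.canonicalTree_sup`).
Deleting a free edge also preserves `T` (`canonicalTree_eq_of_le`). A toggle therefore keeps tree
and marks, hence also the minimal unmarked descent and its companion, and a second toggle undoes the
first. -/

namespace NoncrossingGraph

/-! ### Increasing paths and first edges of cycles -/

/-- A step along an edge of `G` to a larger vertex. -/
def UpStep {n : ℕ} (G : SimpleGraph (Fin (n + 1))) (x y : Fin (n + 1)) : Prop :=
  G.Adj x y ∧ x < y

theorem le_of_upStep {n : ℕ} {G : SimpleGraph (Fin (n + 1))} {x y : Fin (n + 1)}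
    (h : Relation.ReflTransGen (UpStep G) x y) : x ≤ y := by
  induction h with
  | refl => exact le_rfl
  | tail _ h ih => exact ih.trans h.2.le

theorem IsNoncrossing.mono {n : ℕ} {G H : SimpleGraph (Fin (n + 1))} (hle : H ≤ G)
    (h : IsNoncrossing G) : IsNoncrossing H :=
  fun a b c d hab hbc hcd hac hbd => h a b c d hab hbc hcd (hle hac) (hle hbd)

/-- An increasing path from `b` to `y` has a step passing over any given intermediate vertex. -/
theorem exists_upStep_over {n : ℕ} {G : SimpleGraph (Fin (n + 1))} {b y x : Fin (n + 1)}
    (h : Relation.ReflTransGen (UpStep G) b y) (hbx : b ≤ x) (hxy : x < y) :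
    ∃ s t, Relation.ReflTransGen (UpStep G) b s ∧ G.Adj s t ∧ s ≤ x ∧ x < t ∧ t ≤ y := by
  induction h with
  | refl => exact absurd hxy (not_lt.2 hbx)
  | @tail u v hu huv ih =>
    rcases lt_or_ge x u with hxu | hux
    · obtain ⟨s, t, h1, h2, h3, h4, h5⟩ := ih hxu
      exact ⟨s, t, h1, h2, h3, h4, h5.trans huv.2.le⟩
    · exact ⟨u, v, hu, huv.1, hux, hxy, le_rfl⟩

/-- Let `z` be the largest vertex up to `y` that an increasing path from `b` reaches. If `z < y`, an
edge from a vertex in `(a, z]` to one beyond `z` would cross `(a, b)`, `(a, y)` or a step of the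
increasing path, or contradict the choice of `z`. So no walk above `a` gets from `b` to `y`. -/
theorem IsNoncrossing.upStep_of_reachable {n : ℕ} {G : SimpleGraph (Fin (n + 1))}
    (hG : IsNoncrossing G) {a b y : Fin (n + 1)} (hab : a < b) (hby : b < y) (h1 : G.Adj a b)
    (h2 : G.Adj a y)
    (h : Relation.ReflTransGen (fun x z => G.Adj x z ∧ a < x ∧ a < z) b y) :
    Relation.ReflTransGen (UpStep G) b y := by
  classical
  let S : Finset (Fin (n + 1)) :=
    Finset.univ.filter fun z => Relation.ReflTransGen (UpStep G) b z ∧ z ≤ y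
  have hS : S.Nonempty := ⟨b, by simp [S, hby.le, Relation.ReflTransGen.refl]⟩
  obtain ⟨hz, hzy⟩ : Relation.ReflTransGen (UpStep G) b (S.max' hS) ∧ S.max' hS ≤ y := by
    simpa [S] using S.max'_mem hS
  have hmax : ∀ x, Relation.ReflTransGen (UpStep G) b x → x ≤ y → x ≤ S.max' hS :=
    fun x hx hxy => S.le_max' x (by simp [S, hx, hxy])
  generalize S.max' hS = z at hz hzy hmax
  rcases hzy.eq_or_lt with rfl | hzy
  · exact hz
  have hbz := le_of_upStep hz
  have up : ∀ s t, Relation.ReflTransGen (UpStep G) b s → G.Adj s t → s ≤ z → ¬ z < t := by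
    intro s t hs hst hsz hzt
    have hbs := le_of_upStep hs
    rcases le_or_gt t y with hty | hyt
    · exact absurd (hmax t (hs.tail ⟨hst, hsz.trans_lt hzt⟩) hty) (not_le.2 hzt)
    · exact hG a s y t (hab.trans_le hbs) (hsz.trans_lt hzy) hyt h2 hst
  have stay : ∀ x, Relation.ReflTransGen (fun x z => G.Adj x z ∧ a < x ∧ a < z) b x → x ≤ z := by
    intro x hx
    induction hx with
    | refl => exact hbz
    | @tail u v _ huv ih =>
      by_contra! hzv
      obtain ⟨huv, hau, hav⟩ := huv
      rcases lt_or_ge u b with hub | hbu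
      · exact hG a u b v hau hub (hbz.trans_lt hzv) h1 huv
      rcases ih.eq_or_lt with rfl | huz
      · exact up u v hz huv le_rfl hzv
      obtain ⟨s, t, hs, hst, hsu, hut, htz⟩ := exists_upStep_over hz hbu huz
      rcases hsu.eq_or_lt with rfl | hsu
      · exact up s v hs huv ih hzv
      · exact hG s u t v hsu hut (htz.trans_lt hzv) hst huv
  exact absurd (stay y h) (not_le.2 hzy)

theorem isFirstEdge_of_upStep {n : ℕ} {G : SimpleGraph (Fin (n + 1))} {a b y : Fin (n + 1)}
    (hab : a < b) (hby : b < y) (h1 : G.Adj a b) (h2 : G.Adj a y)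
    (h : Relation.ReflTransGen (UpStep G) b y) : IsFirstEdge G a b := by
  have key : ∀ x, Relation.ReflTransGen (UpStep G) x y →
      ∃ (k : ℕ) (c : Fin (k + 1) → Fin (n + 1)), (∀ t : Fin k, UpStep G (c t.castSucc) (c t.succ)) ∧
        c 0 = x ∧ c (Fin.last k) = y := by
    intro x hx
    induction hx using Relation.ReflTransGen.head_induction_on with
    | refl => exact ⟨0, fun _ => y, fun t => t.elim0, rfl, rfl⟩
    | @head u v huv _ ih =>
      obtain ⟨k, c, hc, h0, hl⟩ := ih
      refine ⟨k + 1, Fin.cons u c, fun t => ?_, rfl, ?_⟩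
      · refine Fin.cases ?_ (fun s => ?_) t
        · simpa [h0] using huv
        · simpa [Fin.castSucc_succ] using hc s
      · rw [← Fin.succ_last, Fin.cons_succ, hl]
  obtain ⟨k, c, hc, h0, hl⟩ := key b h
  obtain _ | k := k
  · exact absurd (h0.symm.trans hl) hby.ne
  have hstep : ∀ t : Fin (k + 2), UpStep G ((Fin.cons a c : Fin (k + 3) → Fin (n + 1)) t.castSucc)
      ((Fin.cons a c : Fin (k + 3) → Fin (n + 1)) t.succ) := by
    refine fun t => Fin.cases ?_ (fun s => ?_) t
    · simpa [h0] using ⟨h1, hab⟩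
    · simpa [Fin.castSucc_succ] using hc s
  refine ⟨k, Fin.cons a c, ⟨Fin.strictMono_iff_lt_succ.2 fun t => (hstep t).2,
    fun t => (hstep t).1, ?_⟩, rfl, h0⟩
  rw [← Fin.succ_last, Fin.cons_succ, hl]
  exact h2.symm

theorem IsFirstEdge.adj {n : ℕ} {G : SimpleGraph (Fin (n + 1))} {a b : Fin (n + 1)}
    (h : IsFirstEdge G a b) : G.Adj a b := by
  obtain ⟨k, c, hc, rfl, rfl⟩ := h
  exact hc.adj_succ 0

/-- The bound `b ≤ u` keeps the path away from `a`, hence off the edge `(a, b)` itself. -/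
theorem IsFirstEdge.exists_upStep {n : ℕ} {G : SimpleGraph (Fin (n + 1))} {a b : Fin (n + 1)}
    (h : IsFirstEdge G a b) : ∃ y, b < y ∧ G.Adj a y ∧
      Relation.ReflTransGen (fun u v => UpStep G u v ∧ b ≤ u) b y := by
  obtain ⟨k, c, hc, rfl, rfl⟩ := h
  refine ⟨c (Fin.last (k + 2)), hc.strictMono (by simp [Fin.lt_def]), hc.adj_last.symm, ?_⟩
  have key : ∀ m : ℕ, ∀ hm : m < k + 2,
      Relation.ReflTransGen (fun u v => UpStep G u v ∧ c 1 ≤ u) (c 1) (c (Fin.succ ⟨m, hm⟩)) := by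
    intro m
    induction m with
    | zero => intro hm; exact Relation.ReflTransGen.refl
    | succ m ih =>
      intro hm
      exact (ih (by omega)).tail ⟨⟨hc.adj_succ ⟨m + 1, hm⟩, hc.strictMono (by simp [Fin.lt_def])⟩,
        hc.strictMono.monotone (by simp [Fin.le_def])⟩
  exact key (k + 1) (by omega)

/-! ### The canonical spanning tree is a tree -/

/-- On any cycle, the two neighbours of the smallest vertex `a` are joined by an arc of vertices
above `a`. Planarity replaces the arc by an increasing path, which makes an edge at `a` a first
edge. -/
theorem IsNoncrossing.isAcyclic {n : ℕ} {G : SimpleGraph (Fin (n + 1))} (hG : IsNoncrossing G)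
    (h : ∀ a b, ¬ IsFirstEdge G a b) : G.IsAcyclic := by
  intro v p hp
  have hne : p.support.toFinset.Nonempty := ⟨v, by simp⟩
  have ha : p.support.toFinset.min' hne ∈ p.support := by
    simpa using p.support.toFinset.min'_mem hne
  have hmin : ∀ x ∈ p.support, p.support.toFinset.min' hne ≤ x :=
    fun x hx => Finset.min'_le _ _ (by simpa using hx)
  generalize p.support.toFinset.min' hne = a at ha hmin
  have hq : (p.rotate a ha).IsCycle := hp.rotate ha
  have hminq : ∀ x ∈ (p.rotate a ha).support, a ≤ x := fun x hx =>
    hmin x ((SimpleGraph.Walk.mem_support_rotate_iff _ _ _).1 hx)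
  generalize p.rotate a ha = q at hq hminq
  have hlen := hq.three_le_length
  have hgt : ∀ i, 0 < i → i < q.length → a < q.getVert i := by
    intro i h0 hi
    refine lt_of_le_of_ne (hminq _ (q.getVert_mem_support i)) fun he => ?_
    rcases (hq.getVert_endpoint_iff hi.le).1 he.symm with h | h <;> omega
  have reach : ∀ i, i + 1 < q.length → Relation.ReflTransGen
      (fun x z => G.Adj x z ∧ a < x ∧ a < z) (q.getVert 1) (q.getVert (i + 1)) := by
    intro i
    induction i with
    | zero => intro _; exact Relation.ReflTransGen.refl
    | succ i ih =>
      intro hi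
      exact (ih (by omega)).tail ⟨q.adj_getVert_succ (by omega), hgt _ (by omega) (by omega),
        hgt _ (by omega) hi⟩
  have hr := reach (q.length - 2) (by omega)
  rw [show q.length - 2 + 1 = q.length - 1 by omega] at hr
  have h1 : G.Adj a (q.getVert 1) := by
    have := q.adj_getVert_succ (i := 0) (by omega)
    rwa [q.getVert_zero] at this
  have h2 : G.Adj a (q.getVert (q.length - 1)) := by
    have := q.adj_getVert_succ (i := q.length - 1) (by omega)
    rw [show q.length - 1 + 1 = q.length by omega, q.getVert_length] at this
    exact this.symm
  have hsymm := @Relation.ReflTransGen.stdSymm _ (fun x z => G.Adj x z ∧ a < x ∧ a < z)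
    ⟨fun _ _ h => ⟨h.1.symm, h.2.2, h.2.1⟩⟩
  have hb := hgt 1 (by omega) (by omega)
  have hy := hgt (q.length - 1) (by omega) (by omega)
  rcases lt_trichotomy (q.getVert 1) (q.getVert (q.length - 1)) with hlt | he | hlt
  · exact h _ _ (isFirstEdge_of_upStep hb hlt h1 h2 (hG.upStep_of_reachable hb hlt h1 h2 hr))
  · exact hq.snd_ne_penultimate he
  · exact h _ _ (isFirstEdge_of_upStep hy hlt h2 h1
      (hG.upStep_of_reachable hy hlt h2 h1 (hsymm.symm _ _ hr)))

theorem IsFirstEdge.connected_deleteEdges {n : ℕ} {G : SimpleGraph (Fin (n + 1))}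
    {a b : Fin (n + 1)} (h : IsFirstEdge G a b) (hG : G.Connected) :
    (G.deleteEdges {s(a, b)}).Connected := by
  refine hG.connected_delete_edge_of_not_isBridge fun hb => ?_
  rw [SimpleGraph.isBridge_iff] at hb
  refine hb (SimpleGraph.Reachable.symm ?_)
  rw [SimpleGraph.reachable_iff_reflTransGen]
  refine Relation.ReflTransGen.mono ?_ _ _ h.detour
  rintro u v ⟨huv, -, -, hn⟩
  rw [SimpleGraph.deleteEdges_adj]
  exact ⟨huv, hn⟩

theorem canonicalTree_le {n : ℕ} (G : SimpleGraph (Fin (n + 1))) : canonicalTree G ≤ G :=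
  SimpleGraph.deleteEdges_le _

/-- Deleting a first edge preserves connectedness, and a noncrossing graph without first edges is
acyclic, so the procedure can only stop at a tree. -/
theorem exists_deletions_isTree {n : ℕ} {G : SimpleGraph (Fin (n + 1))} (hc : G.Connected)
    (hG : IsNoncrossing G) : ∃ T, Relation.ReflTransGen DeletionStep G T ∧ T.IsTree := by
  induction hm : G.edgeSet.ncard using Nat.strong_induction_on generalizing G with
  | _ m ih =>
    by_cases h : ∃ a b, IsFirstEdge G a b
    · obtain ⟨a, b, hab⟩ := h
      have hlt : (G.deleteEdges {s(a, b)}).edgeSet.ncard < m := by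
        rw [← hm, SimpleGraph.edgeSet_deleteEdges]
        exact Set.ncard_sdiff_singleton_lt_of_mem hab.adj (Set.toFinite _)
      obtain ⟨T, hT, htree⟩ := ih _ hlt (hab.connected_deleteEdges hc)
        (hG.mono (SimpleGraph.deleteEdges_le _)) rfl
      exact ⟨T, hT.head ⟨a, b, hab, rfl⟩, htree⟩
    · push Not at h
      exact ⟨G, Relation.ReflTransGen.refl, hc, hG.isAcyclic h⟩

theorem isTree_canonicalTree {n : ℕ} {G : SimpleGraph (Fin (n + 1))} (hc : G.Connected)
    (hG : IsNoncrossing G) : (canonicalTree G).IsTree := by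
  obtain ⟨T, hT, htree⟩ := exists_deletions_isTree hc hG
  exact eq_canonicalTree_of_deletions hT htree ▸ htree

theorem eq_of_le_of_isTree {n : ℕ} {S T : SimpleGraph (Fin (n + 1))} (hS : S.IsTree)
    (hT : T.IsTree) (h : S ≤ T) : S = T :=
  h.antisymm ((SimpleGraph.isTree_iff_maximal_isAcyclic.1 hS).2.2 hT.isAcyclic h)

theorem not_isFirstEdge_of_canonicalTree_adj {n : ℕ} {G : SimpleGraph (Fin (n + 1))}
    {a b : Fin (n + 1)} (h : (canonicalTree G).Adj a b) : ¬ IsFirstEdge G a b := by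
  rw [canonicalTree, SimpleGraph.deleteEdges_adj] at h
  exact fun hab => h.2 ⟨a, b, hab, rfl⟩

theorem canonicalTree_adj_of_isFirstEdge_imp {n : ℕ} {G H : SimpleGraph (Fin (n + 1))}
    (hF : ∀ a b, IsFirstEdge H a b → IsFirstEdge G a b) {x y : Fin (n + 1)}
    (h : (canonicalTree G).Adj x y) (hxy : H.Adj x y) : (canonicalTree H).Adj x y := by
  rw [canonicalTree, SimpleGraph.deleteEdges_adj] at h ⊢
  refine ⟨hxy, ?_⟩
  rintro ⟨a, b, hab, he⟩
  exact h.2 ⟨a, b, hF a b hab, he⟩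

/-- The canonical spanning tree does not change when free edges are deleted. -/
theorem canonicalTree_eq_of_le {n : ℕ} {G H : SimpleGraph (Fin (n + 1))} (hc : G.Connected)
    (hG : IsNoncrossing G) (h1 : canonicalTree G ≤ H) (h2 : H ≤ G) :
    canonicalTree H = canonicalTree G :=
  have hT := isTree_canonicalTree hc hG
  (eq_of_le_of_isTree hT
    (isTree_canonicalTree (hT.connected.mono h1) (hG.mono h2)) fun _ _ h =>
      canonicalTree_adj_of_isFirstEdge_imp (fun _ _ hab => hab.mono h2) h (h1 h)).symm

/-! ### Parents and descents in the rooted tree -/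

/-- `i` is the parent of `j` in the tree `T` rooted at `0`. -/
def IsParent {n : ℕ} (T : SimpleGraph (Fin (n + 1))) (i j : Fin (n + 1)) : Prop :=
  T.Adj i j ∧ T.dist 0 j = T.dist 0 i + 1

theorem isParent_or {n : ℕ} {T : SimpleGraph (Fin (n + 1))} (hT : T.IsTree) {i j : Fin (n + 1)}
    (h : T.Adj i j) : IsParent T i j ∨ IsParent T j i := by
  rcases hT.dist_eq_dist_add_one_of_adj 0 h with h' | h'
  · exact Or.inr ⟨h.symm, h'⟩
  · exact Or.inl ⟨h, h'⟩

theorem IsParent.exists_isPath {n : ℕ} {T : SimpleGraph (Fin (n + 1))} (hT : T.IsTree)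
    {i j : Fin (n + 1)} (h : IsParent T i j) :
    ∃ p : T.Walk 0 j, p.IsPath ∧ p.penultimate = i ∧ i ∈ p.support := by
  obtain ⟨q, hq⟩ := hT.connected.exists_walk_length_eq_dist 0 i
  refine ⟨q.concat h.1, SimpleGraph.Walk.isPath_of_length_eq_dist _ ?_, by simp, ?_⟩
  · rw [SimpleGraph.Walk.length_concat, hq, h.2]
  · simp [SimpleGraph.Walk.support_concat]

theorem IsParent.unique {n : ℕ} {T : SimpleGraph (Fin (n + 1))} (hT : T.IsTree)
    {i i' j : Fin (n + 1)} (h : IsParent T i j) (h' : IsParent T i' j) : i = i' := by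
  obtain ⟨p, hp, rfl, -⟩ := h.exists_isPath hT
  obtain ⟨q, hq, rfl, -⟩ := h'.exists_isPath hT
  rw [(hT.existsUnique_path 0 j).unique hp hq]

theorem exists_isParent {n : ℕ} {T : SimpleGraph (Fin (n + 1))} (hT : T.IsTree)
    {j : Fin (n + 1)} (h : j ≠ 0) : ∃ i, IsParent T i j := by
  obtain ⟨p, hp⟩ := hT.connected.exists_walk_length_eq_dist j 0
  cases p with
  | nil => exact absurd rfl h
  | @cons _ i _ hji q =>
    rcases isParent_or hT hji with h' | h'
    · have h1 := SimpleGraph.dist_le q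
      have h2 := h'.2
      rw [SimpleGraph.Walk.length_cons, SimpleGraph.dist_comm] at hp
      rw [SimpleGraph.dist_comm] at h1
      omega
    · exact ⟨i, h'⟩

theorem isDescent_iff {n : ℕ} {T : SimpleGraph (Fin (n + 1))} (hT : T.IsTree)
    {i j : Fin (n + 1)} : IsDescent T i j ↔ IsParent T i j ∧ j < i := by
  constructor
  · rintro ⟨hij, hlt, p, hp, hi⟩
    refine ⟨(isParent_or hT hij).resolve_right fun h => ?_, hlt⟩
    obtain ⟨q, hq, -, hj⟩ := h.exists_isPath hT
    have hnot := hT.isAcyclic.ne_mem_support_of_support_of_adj_of_isPath hp hq hij.symm hi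
    exact hnot hj
  · rintro ⟨h, hlt⟩
    obtain ⟨p, hp, -, hi⟩ := h.exists_isPath hT
    exact ⟨h.1, hlt, p, hp, hi⟩

theorem IsDescent.upStep {n : ℕ} {T : SimpleGraph (Fin (n + 1))} {i j : Fin (n + 1)}
    (h : IsDescent T i j) : UpStep T j i :=
  ⟨h.1.symm, h.2.1⟩

theorem OnDescentPath.upStep {n : ℕ} {T : SimpleGraph (Fin (n + 1))} {j u : Fin (n + 1)}
    (h : OnDescentPath T j u) : Relation.ReflTransGen (UpStep T) j u :=
  Relation.ReflTransGen.mono (fun _ _ h => IsDescent.upStep h) _ _ h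

theorem OnDescentPath.le {n : ℕ} {T : SimpleGraph (Fin (n + 1))} {j u : Fin (n + 1)}
    (h : OnDescentPath T j u) : j ≤ u :=
  le_of_upStep h.upStep

theorem OnDescentPath.dist_le {n : ℕ} {T : SimpleGraph (Fin (n + 1))} (hT : T.IsTree)
    {j u : Fin (n + 1)} (h : OnDescentPath T j u) : T.dist 0 u ≤ T.dist 0 j := by
  induction h with
  | refl => exact le_rfl
  | tail _ h ih =>
    have := ((isDescent_iff hT).1 h).1.2
    omega

/-- A vertex that an edge of a noncrossing tree separates from the root is farther from the root
than one of the ends of the edge. -/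
theorem min_dist_lt_of_adj {n : ℕ} {T : SimpleGraph (Fin (n + 1))} (hT : T.IsTree)
    (hN : IsNoncrossing T) {a z y : Fin (n + 1)} (haz : a < z) (hzy : z < y) (h : T.Adj a y) :
    min (T.dist 0 a) (T.dist 0 y) < T.dist 0 z := by
  induction hd : T.dist 0 z generalizing z with
  | zero =>
    have : (0 : Fin (n + 1)) = z := (hT.connected.dist_eq_zero_iff).1 hd
    exact absurd haz (by rw [← this]; exact not_lt.2 (Fin.zero_le a))
  | succ d ih =>
    -- The parent `q` of `z` cannot lie strictly beyond the chord `(a, y)`: it is an end of the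
    -- chord, or the induction applies to it.
    obtain ⟨q, hq⟩ := exists_isParent hT (j := z) (by rintro rfl; exact absurd haz (by simp))
    have hqd : T.dist 0 q = d := by have := hq.2; omega
    rcases lt_trichotomy q a with hqa | rfl | haq
    · exact absurd h (fun h => hN q a z y hqa haz hzy hq.1 h)
    · exact (min_le_left _ _).trans_lt (by omega)
    rcases lt_trichotomy q y with hqy | rfl | hyq
    · exact (ih haq hqy hqd).trans (by omega)
    · exact (min_le_right _ _).trans_lt (by omega)
    · exact absurd hq.1.symm (fun h' => hN a z y q haz hzy hyq h h')

/-- If `a` is adjacent to the end `y` of an increasing path that starts above `a`, then this path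
consists of descents. -/
theorem onDescentPath_of_upStep {n : ℕ} {T : SimpleGraph (Fin (n + 1))} (hT : T.IsTree)
    (hN : IsNoncrossing T) {a b y : Fin (n + 1)} (hab : a < b) (hay : T.Adj a y)
    (h : Relation.ReflTransGen (UpStep T) b y) : OnDescentPath T b y := by
  -- Once an increasing path steps from parent to child, it does so forever: each later vertex
  -- already has its unique parent below it.
  have key : ∀ x x' z, IsParent T x x' → x < x' → Relation.ReflTransGen (UpStep T) x' z →
      x < z ∧ T.dist 0 x < T.dist 0 z ∧ ∃ w, x ≤ w ∧ w < z ∧ IsParent T w z := by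
    intro x x' z hx hlt hz
    induction hz with
    | refl => exact ⟨hlt, by have := hx.2; omega, x, le_rfl, hlt, hx⟩
    | @tail u v _ huv ih =>
      obtain ⟨h1, h2, w, h3, h4, h5⟩ := ih
      rcases isParent_or hT huv.1 with hp | hp
      · exact ⟨h1.trans huv.2, by have := hp.2; omega, u, h1.le, huv.2, hp⟩
      · exact absurd (hp.unique hT h5 ▸ h4) (not_lt.2 huv.2.le)
  induction h using Relation.ReflTransGen.head_induction_on with
  | refl => exact Relation.ReflTransGen.refl
  | @head u v huv hv ih =>
    rcases isParent_or hT huv.1 with hp | hp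
    · exfalso
      obtain ⟨h1, h2, w, h3, h4, h5⟩ := key u v y hp huv.2 hv
      -- If `a` is the parent of `y`, it equals `w ≥ u > a`. Otherwise `y` is the end of the chord
      -- nearer to the root, so `u`, lying under the chord, is farther from the root than `y`,
      -- against `h2`.
      rcases isParent_or hT hay with hq | hq
      · exact absurd (hq.unique hT h5) (hab.trans_le h3).ne
      · have h6 := min_dist_lt_of_adj hT hN hab h1 hay
        have h7 := hq.2
        rw [min_lt_iff] at h6
        omega
    · exact (ih (hab.trans huv.2)).head ((isDescent_iff hT).2 ⟨hp, huv.2⟩)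

theorem OnDescentPath.cases_lt {n : ℕ} {T : SimpleGraph (Fin (n + 1))} {j u : Fin (n + 1)}
    (h : OnDescentPath T j u) (hju : j < u) : ∃ i, IsDescent T i j ∧ OnDescentPath T i u := by
  rcases Relation.ReflTransGen.cases_head h with rfl | ⟨i, h1, h2⟩
  · exact absurd hju (lt_irrefl _)
  · exact ⟨i, h1, h2⟩

/-! ### Existence of companion edges -/

/-- Follow the descents towards the root until the parent `x` is the smaller end. The chord `(j, i)`
and the distances to the root force `x < j`. -/
theorem exists_mem_companionSet {n : ℕ} {T : SimpleGraph (Fin (n + 1))} (hT : T.IsTree)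
    (hN : IsNoncrossing T) {i j : Fin (n + 1)} (h : IsDescent T i j) :
    ∃ x u, x < j ∧ OnDescentPath T i u ∧ IsParent T x u := by
  induction hd : T.dist 0 i using Nat.strong_induction_on generalizing i j with
  | _ d ih =>
    obtain ⟨hij, hlt⟩ := (isDescent_iff hT).1 h
    obtain ⟨p, hp⟩ := exists_isParent hT (j := i) (by rintro rfl; exact absurd hlt (by simp))
    have hpd := hp.2
    have hjd := hij.2
    rcases lt_trichotomy p i with hpi | rfl | hip
    · rcases lt_trichotomy p j with hpj | rfl | hjp
      · exact ⟨p, i, hpj, Relation.ReflTransGen.refl, hp⟩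
      · omega
      · have := min_dist_lt_of_adj hT hN hjp hpi hij.1.symm
        rw [min_lt_iff] at this
        omega
    · exact absurd hp.1 (T.irrefl)
    · have hdes : IsDescent T p i := (isDescent_iff hT).2 ⟨hp, hip⟩
      obtain ⟨x, u, hx, hu, hxu⟩ := ih (T.dist 0 p) (by omega) hdes rfl
      have hud := hu.dist_le hT
      refine ⟨x, u, ?_, Relation.ReflTransGen.head hdes hu, hxu⟩
      rcases lt_trichotomy x j with hxj | rfl | hjx
      · exact hxj
      · have := hxu.2
        omega
      · exact absurd hxu.1 (hN j x i u hjx hx (hip.trans_le hu.le) hij.1.symm)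

theorem exists_isCompanion {n : ℕ} {T : SimpleGraph (Fin (n + 1))} (hT : T.IsTree)
    (hN : IsNoncrossing T) {i j : Fin (n + 1)} (h : IsDescent T i j) :
    ∃ w, IsCompanion T i j w := by
  obtain ⟨x, u, hx, hu, hxu⟩ := exists_mem_companionSet hT hN h
  have hne : {x | x < j ∧ ¬ OnDescentPath T j x ∧ ∃ u, OnDescentPath T i u ∧ T.Adj u x}.Nonempty :=
    ⟨x, hx, fun h' => absurd h'.le (not_le.2 hx), u, hu, hxu.1.symm⟩
  obtain ⟨w, hw⟩ := (Set.toFinite _).exists_maximal hne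
  exact ⟨w, hw.1, fun y hy => not_lt.1 fun hlt => hlt.not_ge (hw.2 hy hlt.le)⟩

/-! ### Free edges are companion edges -/

theorem exists_onDescentPath_of_free {n : ℕ} {G : SimpleGraph (Fin (n + 1))} (hc : G.Connected)
    (hG : IsNoncrossing G) {a b : Fin (n + 1)} (hlt : a < b) (hab : G.Adj a b)
    (hfree : ¬ (canonicalTree G).Adj a b) :
    ∃ y, b < y ∧ (canonicalTree G).Adj a y ∧ OnDescentPath (canonicalTree G) b y := by
  have hT := isTree_canonicalTree hc hG
  have hTN := hG.mono (canonicalTree_le G)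
  have hle : canonicalTree G ⊔ SimpleGraph.edge a b ≤ G :=
    sup_le (canonicalTree_le G) ((SimpleGraph.edge_le_iff G).2 (Or.inr hab))
  have hadj : ∀ {x y}, (canonicalTree G ⊔ SimpleGraph.edge a b).Adj x y → x < y → (x, y) ≠ (a, b) →
      (canonicalTree G).Adj x y := by
    intro x y hxy hxy' hne
    rcases hxy with h | h
    · exact h
    · rw [SimpleGraph.edge_adj] at h
      rcases h.1 with ⟨rfl, rfl⟩ | ⟨rfl, rfl⟩
      · exact absurd rfl hne
      · exact absurd hxy' (not_lt.2 hlt.le)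
  obtain ⟨a', b', hF⟩ : ∃ a' b', IsFirstEdge (canonicalTree G ⊔ SimpleGraph.edge a b) a' b' := by
    by_contra! hno
    have hac := (hG.mono hle).isAcyclic hno
    have := (SimpleGraph.isTree_iff_maximal_isAcyclic.1 hT).2.2 hac le_sup_left
    exact hfree (this (Or.inr (by simp [SimpleGraph.edge_adj, hlt.ne])))
  have heq : (a', b') = (a, b) := by
    by_contra hne
    exact not_isFirstEdge_of_canonicalTree_adj (hadj hF.adj hF.lt hne) (hF.mono hle)
  obtain ⟨rfl, rfl⟩ := Prod.ext_iff.1 heq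
  obtain ⟨y, hby, hay, hpath⟩ := hF.exists_upStep
  have hay' := hadj hay (hlt.trans hby) (by simpa using hby.ne')
  refine ⟨y, hby, hay', onDescentPath_of_upStep hT hTN hlt hay' ?_⟩
  refine Relation.ReflTransGen.mono ?_ _ _ hpath
  rintro u v ⟨huv, hu⟩
  exact ⟨hadj huv.1 huv.2 (by simpa using fun h => absurd h (hlt.trans_le hu).ne'), huv.2⟩

/-- Each free edge is the companion edge of a descent of the canonical spanning tree. -/
theorem exists_isCompanion_of_free {n : ℕ} {G : SimpleGraph (Fin (n + 1))} (hc : G.Connected)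
    (hG : IsNoncrossing G) {a b : Fin (n + 1)} (hlt : a < b) (hab : G.Adj a b)
    (hfree : ¬ (canonicalTree G).Adj a b) :
    ∃ i, IsDescent (canonicalTree G) i b ∧ IsCompanion (canonicalTree G) i b a := by
  obtain ⟨y, hby, hay, hpath⟩ := exists_onDescentPath_of_free hc hG hlt hab hfree
  obtain ⟨i, hi, hiy⟩ := hpath.cases_lt hby
  refine ⟨i, hi, ⟨hlt, fun h => absurd h.le (not_le.2 hlt), y, hiy, hay.symm⟩, ?_⟩
  rintro x ⟨hxb, -, u, hu, hux⟩
  by_contra! hax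
  -- A larger candidate `x` would have a tree edge to `u > b` crossing `(a, b)`.
  exact hG a x b u hax hxb (hi.2.1.trans_le hu.le) hab (canonicalTree_le G hux.symm)

theorem IsCompanion.lt {n : ℕ} {T : SimpleGraph (Fin (n + 1))} {i j w : Fin (n + 1)}
    (h : IsCompanion T i j w) : w < j :=
  h.1.1

/-- The companion edge of a descent is not an edge of the tree. -/
theorem IsCompanion.not_adj {n : ℕ} {T : SimpleGraph (Fin (n + 1))} (hT : T.IsTree)
    {i j w : Fin (n + 1)} (hij : IsDescent T i j) (h : IsCompanion T i j w) : ¬ T.Adj w j := by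
  obtain ⟨⟨hwj, hw, u, hu, huw⟩, -⟩ := h
  intro hadj
  have hF : IsFirstEdge T w j :=
    isFirstEdge_of_upStep hwj (hij.2.1.trans_le hu.le) hadj huw.symm
      (Relation.ReflTransGen.head hij.upStep hu.upStep)
  have hbr := SimpleGraph.isAcyclic_iff_forall_adj_isBridge.1 hT.isAcyclic hadj
  exact SimpleGraph.isBridge_iff.1 hbr ((hF.connected_deleteEdges hT.connected) w j)

/-! ### Adding a companion edge -/

/-- If `y` were not on the path, some descent would pass over it and cross `(x, y)`. -/
theorem onDescentPath_of_adj {n : ℕ} {G T : SimpleGraph (Fin (n + 1))} (hle : T ≤ G)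
    (hG : IsNoncrossing G) {j u x y : Fin (n + 1)} (h : OnDescentPath T j u) (hxj : x < j)
    (hjy : j ≤ y) (hyu : y ≤ u) (hxy : G.Adj x y) : OnDescentPath T j y := by
  induction h using Relation.ReflTransGen.head_induction_on with
  | refl => exact le_antisymm hjy hyu ▸ Relation.ReflTransGen.refl
  | @head j j' hj _ ih =>
    rcases hjy.eq_or_lt with rfl | hjy
    · exact Relation.ReflTransGen.refl
    rcases lt_or_ge y j' with hyj | hjy'
    · exact absurd (hle hj.1.symm) (hG x j y j' hxj hjy hyj hxy)
    · exact Relation.ReflTransGen.head hj (ih (hxj.trans hj.2.1) hjy')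

/-- A companion edge crosses no edge of the graph. -/
theorem IsCompanion.isNoncrossing_sup {n : ℕ} {G : SimpleGraph (Fin (n + 1))} (hc : G.Connected)
    (hG : IsNoncrossing G) {i j w : Fin (n + 1)} (hij : IsDescent (canonicalTree G) i j)
    (h : IsCompanion (canonicalTree G) i j w) : IsNoncrossing (G ⊔ SimpleGraph.edge w j) := by
  obtain ⟨⟨hwj, -, u, hu, huw⟩, hmax⟩ := h
  have hji := hij.2.1
  have hju : j < u := hji.trans_le hu.le
  have hle := canonicalTree_le G
  -- Since `(w, u)` is not crossed, `y ≤ u`, so `y` is on the descent path. Then `x` is a tree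
  -- neighbour of `y`, or of a vertex further up if `(x, y)` is free, and it beats the maximal `w`.
  have right : ∀ x y, w < x → x < j → j < y → ¬ G.Adj x y := by
    intro x y hwx hxj hjy hxy
    have hyu : y ≤ u := not_lt.1 fun huy =>
      hG w x u y hwx (hxj.trans hju) huy (hle huw.symm) hxy
    have hy : OnDescentPath (canonicalTree G) i y := by
      obtain ⟨i', hi', hy⟩ := (onDescentPath_of_adj hle hG
        (Relation.ReflTransGen.head hij hu : OnDescentPath _ j u) hxj hjy.le hyu hxy).cases_lt hjy
      have hT := isTree_canonicalTree hc hG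
      rwa [((isDescent_iff hT).1 hij).1.unique hT ((isDescent_iff hT).1 hi').1]
    have hx : ∃ y', OnDescentPath (canonicalTree G) i y' ∧ (canonicalTree G).Adj y' x := by
      by_cases hxyT : (canonicalTree G).Adj x y
      · exact ⟨y, hy, hxyT.symm⟩
      · obtain ⟨y', -, h1, h2⟩ := exists_onDescentPath_of_free hc hG (hxj.trans hjy) hxy hxyT
        exact ⟨y', Relation.ReflTransGen.trans hy h2, h1.symm⟩
    exact absurd (hmax ⟨hxj, fun h => absurd h.le (not_le.2 hxj), hx⟩) (not_le.2 hwx)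
  have edge : ∀ {x y}, x < y → (SimpleGraph.edge w j).Adj x y → x = w ∧ y = j := by
    intro x y hxy hadj
    rw [SimpleGraph.edge_adj] at hadj
    rcases hadj.1 with h | ⟨rfl, rfl⟩
    · exact h
    · exact absurd hxy (not_lt.2 hwj.le)
  intro a b c d hab hbc hcd hac hbd
  rcases hac with hac | hac <;> rcases hbd with hbd | hbd
  · exact hG a b c d hab hbc hcd hac hbd
  · obtain ⟨rfl, rfl⟩ := edge (hbc.trans hcd) hbd
    -- An edge crossing `(w, j)` from below `w` also crosses `(w, u)`.
    exact hG a b c u hab hbc (hcd.trans hju) hac (hle huw.symm)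
  · obtain ⟨rfl, rfl⟩ := edge (hab.trans hbc) hac
    exact right b d hab hbc hcd hbd
  · obtain ⟨rfl, rfl⟩ := edge (hab.trans hbc) hac
    exact hab.ne (edge (hbc.trans hcd) hbd).1.symm

/-- The canonical spanning tree does not change when the companion edge of a descent is added. -/
theorem IsCompanion.canonicalTree_sup {n : ℕ} {G : SimpleGraph (Fin (n + 1))} (hc : G.Connected)
    (hG : IsNoncrossing G) {i j w : Fin (n + 1)} (hij : IsDescent (canonicalTree G) i j)
    (h : IsCompanion (canonicalTree G) i j w) :
    canonicalTree (G ⊔ SimpleGraph.edge w j) = canonicalTree G := by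
  have hN := h.isNoncrossing_sup hc hG hij
  obtain ⟨⟨hwj, -, u, hu, huw⟩, -⟩ := h
  have hle : canonicalTree G ≤ G ⊔ SimpleGraph.edge w j := (canonicalTree_le G).trans le_sup_left
  have hwj' : (G ⊔ SimpleGraph.edge w j).Adj w j := Or.inr (by simp [SimpleGraph.edge_adj, hwj.ne])
  have hF : IsFirstEdge (G ⊔ SimpleGraph.edge w j) w j := by
    refine isFirstEdge_of_upStep hwj (hij.2.1.trans_le hu.le) hwj' (hle huw.symm) ?_
    refine Relation.ReflTransGen.mono (fun x y hxy => ⟨hle hxy.1, hxy.2⟩) _ _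
      (Relation.ReflTransGen.head hij.upStep hu.upStep)
  -- The new tree omits the first edge `(w, j)`, so it lies in `G`. First edges of `G` remain first
  -- edges, so it lies in the old tree.
  refine eq_of_le_of_isTree (isTree_canonicalTree (hc.mono le_sup_left) hN)
    (isTree_canonicalTree hc hG) fun x y hxy => ?_
  refine canonicalTree_adj_of_isFirstEdge_imp (fun _ _ hab => hab.mono le_sup_left) hxy ?_
  rcases canonicalTree_le _ hxy with h | h
  · exact h
  · rw [SimpleGraph.edge_adj] at h
    rcases h.1 with ⟨rfl, rfl⟩ | ⟨rfl, rfl⟩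
    · exact absurd hF (not_isFirstEdge_of_canonicalTree_adj hxy)
    · exact absurd hF (not_isFirstEdge_of_canonicalTree_adj hxy.symm)

theorem IsCompanion.unique {n : ℕ} {T : SimpleGraph (Fin (n + 1))} {i j w w' : Fin (n + 1)}
    (h : IsCompanion T i j w) (h' : IsCompanion T i j w') : w = w' :=
  IsGreatest.unique h h'

/-- If every descent is marked, then every free edge is marked. -/
theorem freeEdges_subset_marked {n k : ℕ} {x : MarkedGraph n} (hx : x ∈ setN n k)
    (h : ∀ i j, IsDescent x.tree i j → x.IsMarkedDescent i j) :
    freeEdges x.graph ⊆ (x.marked : Set (Sym2 (Fin (n + 1)))) := by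
  obtain ⟨hc, hG, -, -⟩ := hx
  have key : ∀ a b, a < b → x.graph.Adj a b → ¬ (canonicalTree x.graph).Adj a b →
      s(a, b) ∈ x.marked := by
    intro a b hlt hab hfree
    obtain ⟨i, hi, ha⟩ := exists_isCompanion_of_free hc hG hlt hab hfree
    obtain ⟨-, w, hw, hm⟩ := h i b hi
    rwa [hw.unique ha] at hm
  intro e he
  induction e with
  | h a b =>
    obtain ⟨hab, hfree⟩ := he
    rw [SimpleGraph.mem_edgeSet] at hab hfree
    rcases lt_trichotomy a b with hlt | rfl | hlt
    · exact key a b hlt hab hfree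
    · exact absurd hab (SimpleGraph.irrefl _)
    · rw [Sym2.eq_swap]
      exact key b a hlt hab.symm (fun h => hfree h.symm)

/-! ### Counting edges and toggling -/

theorem ncard_edgeSet_canonicalTree {n : ℕ} {G : SimpleGraph (Fin (n + 1))} (hc : G.Connected)
    (hG : IsNoncrossing G) : (canonicalTree G).edgeSet.ncard = n := by
  classical
  have h := (isTree_canonicalTree hc hG).card_edgeFinset
  rw [Fintype.card_fin, ← SimpleGraph.coe_edgeFinset, Set.ncard_coe_finset] at *
  omega

/-- The edge count in `setD` is automatic: if all descents are marked, the `k` marked edges are all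
the free edges, and the tree has `n` more. -/
theorem setN_diff_setD (n k : ℕ) :
    setN n k \ setD n k = {x | x ∈ setN n k ∧ ∃ i j, x.IsUnmarkedDescent i j} := by
  ext x
  constructor
  · rintro ⟨hN, hD⟩
    refine ⟨hN, ?_⟩
    by_contra! hno
    have hall : ∀ i j, IsDescent x.tree i j → x.IsMarkedDescent i j := fun i j h => by
      by_contra hm
      exact hno i j ⟨h, hm⟩
    refine hD ⟨hN, ?_, hall⟩
    have hle := SimpleGraph.edgeSet_mono (canonicalTree_le x.graph)
    have hfree : (freeEdges x.graph).ncard = k := by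
      rw [(freeEdges_subset_marked hN hall).antisymm hN.2.2.1, Set.ncard_coe_finset, hN.2.2.2]
    rw [← Set.ncard_sdiff_add_ncard_of_subset hle (Set.toFinite _),
      ncard_edgeSet_canonicalTree hN.1 hN.2.1, add_comm]
    rw [← hfree]
    rfl
  · rintro ⟨hN, i, j, h⟩
    exact ⟨hN, fun hD => h.2 (hD.2.2 i j h.1)⟩

theorem MarkedGraph.exists_isMinUnmarkedDescent {n : ℕ} {x : MarkedGraph n}
    (h : ∃ i j, x.IsUnmarkedDescent i j) : ∃ i j, x.IsMinUnmarkedDescent i j := by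
  obtain ⟨i₀, j₀, h₀⟩ := h
  obtain ⟨j, ⟨i, hi⟩, hmin⟩ :=
    (Set.toFinite {j | ∃ i, x.IsUnmarkedDescent i j}).exists_minimal ⟨j₀, i₀, h₀⟩
  exact ⟨i, j, hi, fun i' j' h' =>
    not_lt.1 fun hlt => hlt.not_ge (hmin ⟨i', h'⟩ hlt.le)⟩

theorem MarkedGraph.IsMinUnmarkedDescent.unique {n : ℕ} {x : MarkedGraph n}
    (hT : x.tree.IsTree) {i j i' j' : Fin (n + 1)} (h : x.IsMinUnmarkedDescent i j)
    (h' : x.IsMinUnmarkedDescent i' j') : i = i' ∧ j = j' := by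
  obtain rfl : j = j' := (h.2 _ _ h'.1).antisymm (h'.2 _ _ h.1)
  exact ⟨((isDescent_iff hT).1 h.1.1).1.unique hT ((isDescent_iff hT).1 h'.1.1).1, rfl⟩

/-- Being unmarked depends only on the tree and the marks, which a toggle keeps. -/
theorem MarkedGraph.isUnmarkedDescent_congr {n : ℕ} {x y : MarkedGraph n} (ht : y.tree = x.tree)
    (hm : y.marked = x.marked) {i j : Fin (n + 1)} :
    y.IsUnmarkedDescent i j ↔ x.IsUnmarkedDescent i j := by
  simp only [MarkedGraph.IsUnmarkedDescent, MarkedGraph.IsMarkedDescent, ht, hm]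

/-- `y` arises from `x` by deleting the edge `(w, j)` if it is in the graph, and by adding it if it
is not. The marked edges are kept. -/
def MarkedGraph.IsToggle {n : ℕ} (x y : MarkedGraph n) (w j : Fin (n + 1)) : Prop :=
  y.marked = x.marked ∧
    ((x.graph.Adj w j ∧ y.graph = x.graph.deleteEdges {s(w, j)} ∧ y.numFree + 1 = x.numFree) ∨
      (¬ x.graph.Adj w j ∧ y.graph = x.graph ⊔ SimpleGraph.edge w j ∧
        y.numFree = x.numFree + 1))

/-- Toggling the companion edge of an unmarked descent preserves the canonical spanning tree. -/
theorem exists_isToggle {n k : ℕ} {x : MarkedGraph n} (hx : x ∈ setN n k) {i j w : Fin (n + 1)}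
    (hij : x.IsUnmarkedDescent i j) (hw : IsCompanion x.tree i j w) :
    ∃ y ∈ setN n k, y.tree = x.tree ∧ x.IsToggle y w j := by
  obtain ⟨hc, hG, hsub, hk⟩ := hx
  have hT := isTree_canonicalTree hc hG
  have hnot : ¬ (canonicalTree x.graph).Adj w j := hw.not_adj hT hij.1
  -- Deleting `(w, j)` therefore loses no marked edge.
  have hmark : s(w, j) ∉ x.marked := fun h => hij.2 ⟨hij.1, w, hw, h⟩
  by_cases hadj : x.graph.Adj w j
  · have hle : canonicalTree x.graph ≤ x.graph.deleteEdges {s(w, j)} := by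
      intro a b hab
      rw [SimpleGraph.deleteEdges_adj]
      refine ⟨canonicalTree_le _ hab, fun he => hnot ?_⟩
      rw [← SimpleGraph.mem_edgeSet] at hab ⊢
      rwa [← show s(a, b) = s(w, j) from he]
    have ht : canonicalTree (x.graph.deleteEdges {s(w, j)}) = canonicalTree x.graph :=
      canonicalTree_eq_of_le hc hG hle (SimpleGraph.deleteEdges_le _)
    have hfree : freeEdges (x.graph.deleteEdges {s(w, j)}) = freeEdges x.graph \ {s(w, j)} := by
      rw [freeEdges, freeEdges, ht, SimpleGraph.edgeSet_deleteEdges]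
      exact sdiff_right_comm ..
    refine ⟨⟨x.graph.deleteEdges {s(w, j)}, x.marked⟩, ⟨hT.connected.mono hle,
      hG.mono (SimpleGraph.deleteEdges_le _), ?_, hk⟩, ht, rfl, Or.inl ⟨hadj, rfl, ?_⟩⟩
    · rw [hfree]
      exact fun e he => ⟨hsub he, fun h => hmark (by rw [← show e = s(w, j) from h]; exact he)⟩
    · simp only [MarkedGraph.numFree, hfree]
      exact Set.ncard_sdiff_singleton_add_one ⟨hadj, hnot⟩ (Set.toFinite _)
  · have ht : canonicalTree (x.graph ⊔ SimpleGraph.edge w j) = canonicalTree x.graph :=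
      hw.canonicalTree_sup hc hG hij.1
    have hfree : freeEdges (x.graph ⊔ SimpleGraph.edge w j) =
        insert s(w, j) (freeEdges x.graph) := by
      rw [freeEdges, freeEdges, ht, SimpleGraph.edgeSet_sup,
        SimpleGraph.edgeSet_edge_of_ne hw.lt.ne, Set.union_sdiff_distrib, Set.union_comm,
        Set.insert_eq,
        (Set.disjoint_singleton_left (s := (canonicalTree x.graph).edgeSet).2 hnot).sdiff_eq_left]
    refine ⟨⟨x.graph ⊔ SimpleGraph.edge w j, x.marked⟩, ⟨hc.mono le_sup_left,
      hw.isNoncrossing_sup hc hG hij.1, ?_, hk⟩, ht, rfl, Or.inr ⟨hadj, rfl, ?_⟩⟩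
    · rw [hfree]
      exact fun e he => Or.inr (hsub he)
    · simp only [MarkedGraph.numFree, hfree]
      exact Set.ncard_insert_of_notMem (fun h => hadj h.1) (Set.toFinite _)

theorem MarkedGraph.IsToggle.eq {n : ℕ} {x y z : MarkedGraph n} {w j : Fin (n + 1)} (hwj : w ≠ j)
    (h : x.IsToggle y w j) (h' : y.IsToggle z w j) : z = x := by
  obtain ⟨hm, h⟩ := h
  obtain ⟨hm', h'⟩ := h'
  refine MarkedGraph.ext ?_ (hm'.trans hm)
  rcases h with ⟨hx, hy, -⟩ | ⟨hx, hy, -⟩ <;> rcases h' with ⟨hy', hz, -⟩ | ⟨hy', hz, -⟩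
  · rw [hy, SimpleGraph.deleteEdges_adj] at hy'
    exact absurd rfl hy'.2
  · rw [hz, hy]
    ext a b
    simp only [SimpleGraph.sup_adj, SimpleGraph.deleteEdges_adj, SimpleGraph.adj_edge,
      Set.mem_singleton_iff]
    constructor
    · rintro (h | ⟨h, -⟩)
      · exact h.1
      · rwa [← SimpleGraph.mem_edgeSet, ← h]
    · intro h
      by_cases he : s(a, b) = s(w, j)
      · exact Or.inr ⟨he.symm, h.ne⟩
      · exact Or.inl ⟨h, he⟩
  · rw [hz, hy]
    ext a b
    simp only [SimpleGraph.sup_adj, SimpleGraph.deleteEdges_adj, SimpleGraph.adj_edge,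
      Set.mem_singleton_iff]
    constructor
    · rintro ⟨h | ⟨h, -⟩, he⟩
      · exact h
      · exact absurd h.symm he
    · refine fun h => ⟨Or.inl h, fun he => hx ?_⟩
      rwa [← SimpleGraph.mem_edgeSet, ← he]
  · rw [hy] at hy'
    exact absurd (Or.inr (by simp [SimpleGraph.edge_adj, hwj])) hy'

end NoncrossingGraph

theorem theorem4 (n k : ℕ) :
    setN n k \ setD n k = {x | x ∈ setN n k ∧ ∃ i j, x.IsUnmarkedDescent i j} ∧
    ∃ ψ : ↥(setN n k \ setD n k) → ↥(setN n k \ setD n k),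
      Function.Involutive ψ ∧
      ∀ x : ↥(setN n k \ setD n k),
        ∃ i j w : Fin (n + 1),
          x.1.IsMinUnmarkedDescent i j ∧
          IsCompanion x.1.tree i j w ∧
          (ψ x).1.marked = x.1.marked ∧
          ((x.1.graph.Adj w j ∧
              (ψ x).1.graph = x.1.graph.deleteEdges {s(w, j)} ∧
              (ψ x).1.numFree + 1 = x.1.numFree) ∨
            (¬ x.1.graph.Adj w j ∧
              (ψ x).1.graph = x.1.graph ⊔ SimpleGraph.edge w j ∧
              (ψ x).1.numFree = x.1.numFree + 1)) := by
  refine ⟨setN_diff_setD n k, ?_⟩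
  have key : ∀ x : ↥(setN n k \ setD n k), ∃ y : ↥(setN n k \ setD n k), y.1.tree = x.1.tree ∧
      ∃ i j w, x.1.IsMinUnmarkedDescent i j ∧ IsCompanion x.1.tree i j w ∧
        x.1.IsToggle y.1 w j := by
    rintro ⟨x, hx⟩
    have hx' := hx
    rw [setN_diff_setD] at hx'
    obtain ⟨hN, hex⟩ := hx'
    obtain ⟨i, j, hij⟩ := MarkedGraph.exists_isMinUnmarkedDescent hex
    obtain ⟨w, hw⟩ := exists_isCompanion (isTree_canonicalTree hN.1 hN.2.1)
      (hN.2.1.mono (canonicalTree_le _)) hij.1.1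
    obtain ⟨y, hy, ht, htog⟩ := exists_isToggle hN hij.1 hw
    have hyu := (MarkedGraph.isUnmarkedDescent_congr ht htog.1).2 hij.1
    refine ⟨⟨y, ?_⟩, ht, i, j, w, hij, hw, htog⟩
    rw [setN_diff_setD]
    exact ⟨hy, i, j, hyu⟩
  choose ψ ht i j w hmin hw htog using key
  refine ⟨ψ, fun x => Subtype.ext ?_, fun x => ⟨i x, j x, w x, hmin x, hw x, htog x⟩⟩
  have hT : x.1.tree.IsTree := isTree_canonicalTree x.2.1.1 x.2.1.2.1
  -- The descent chosen for `ψ x` is also minimal for `x`, so both toggles act on the same edge.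
  have hmin' : x.1.IsMinUnmarkedDescent (i (ψ x)) (j (ψ x)) := by
    have hcongr : ∀ {a b}, (ψ x).1.IsUnmarkedDescent a b ↔ x.1.IsUnmarkedDescent a b :=
      MarkedGraph.isUnmarkedDescent_congr (ht x) (htog x).1
    exact ⟨hcongr.1 (hmin (ψ x)).1, fun a b h => (hmin (ψ x)).2 a b (hcongr.2 h)⟩
  obtain ⟨hi, hj⟩ := hmin'.unique hT (hmin x)
  have hw' := hw (ψ x)
  rw [ht x, hi, hj] at hw'
  have htog' := htog (ψ x)
  rw [hj, hw'.unique (hw x)] at htog'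
  exact (htog x).eq (hw x).lt.ne htog'
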